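/- In the Traveling Salesman Problem with $m$ drones, an instance consists of a finite node set $N$ with a depot $0$, subsets $N^{tr}\ni 0$ and $N^{dr}$ with $N^{tr}\cup N^{dr}=N$ (the nodes that the truck may visit and that the drones may serve), metrics $\ell,\ell'$ on $N$ (travel times of the truck and of the drones), a number $m$ of drones, a drone weight $w^{dr}>0$, payloads $w_i\ge 0$ and a battery capacity $B>0$. A feasible sortie is a sequence $(i_1,\dots,i_r)$, $r\ge 3$, of nodes, consecutive ones distinct, with $i_1,i_r\in N^{tr}$ and $i_2,\dots,i_{r-1}\in N^{dr}$, such that $$w^{dr}\sum_{q=1}^{r-1}\ell'_{i_qi_{q+1}}+\sum_{p=2}^{r-1}w_{i_p}\sum_{q=1}^{p-1}\ell'_{i_qi_{q+1}}\le B .$$ A solution consists of a truck route, which is a closed walk $v_0=0,v_1,\dots,v_n=0$ in $N^{tr}$ with $v_{k}\neq v_{k+1}$, and for each drone a list of feasible sorties, each launched from the truck at one visit of the walk and retrieved by the truck at the same or a later visit; a drone flies one sortie at a time, and every node is visited by the truck or served (as an intermediate node) by a sortie. Truck and drones may wait for each other at the nodes of the walk. The completion time of a solution is the earliest time at which the truck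 has finished its route and all the drones have been retrieved; an optimal solution minimizes it. A solution is arc-retraversing if its truck route traverses some arc $(i,j)$ (from $i$ to $j$) at least twice. Proposition. There is an instance with $15$ nodes and a single drone ($m=1$), all payloads equal to zero, and with both $\ell$ and $\ell'$ equal to the Euclidean distances between $15$ points of the plane, such that an optimal solution exists and every optimal solution is arc-retraversing. Moreover, for this instance, the minimum completion time among all the feasible solutions that are not arc-retraversing is attained and equals $1084.09$ up to rounding to two decimals (i.e. it differs from $1084.09$ by at most $0.005$), while there is a feasible arc-retraversing solution whose completion time equals $1050.36$ up to rounding to two decimals. -/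

import Mathlib

noncomputable section

namespace TSPmD

/-- `d` is a metric on the set `N`. -/
structure IsMetric {N : Type} (d : N → N → ℝ) : Prop where
  eq_zero_iff : ∀ i j, d i j = 0 ↔ i = j
  symm : ∀ i j, d i j = d j i
  triangle : ∀ i j k, d i k ≤ d i j + d j k

/-- An instance of the Traveling Salesman Problem with (multiple) Drones on the node set `N`. -/
structure Problem (N : Type) where
  /-- the depot -/
  depot : N
  /-- the nodes that the truck may visit -/
  truckNodes : Set N
  /-- the nodes that a drone may serve -/
  droneNodes : Set N
  depot_mem : depot ∈ truckNodes
  cover : truckNodes ∪ droneNodes = Set.univ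
  /-- the travel time of the truck between two nodes -/
  truckTime : N → N → ℝ
  /-- the travel time of a drone between two nodes -/
  droneTime : N → N → ℝ
  truckTime_isMetric : IsMetric truckTime
  droneTime_isMetric : IsMetric droneTime
  /-- the number of drones -/
  numDrones : ℕ
  /-- the weight of a drone -/
  droneWeight : ℝ
  droneWeight_pos : 0 < droneWeight
  /-- the payload of a node -/
  payload : N → ℝ
  payload_nonneg : ∀ i, 0 ≤ payload i
  /-- the maximal energy consumption of a sortie -/
  battery : ℝ
  battery_pos : 0 < battery

/-- The total length `d i₁ i₂ + d i₂ i₃ + ⋯` of a sequence of nodes. -/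
def pathLength {N : Type} (d : N → N → ℝ) : List N → ℝ
  | [] => 0
  | [_] => 0
  | i :: j :: l => d i j + pathLength d (j :: l)

/-- A sortie: a starting node, the nodes served (in this order), and an ending node. -/
structure Sortie (N : Type) where
  start : N
  served : List N
  finish : N

namespace Sortie

variable {N : Type}

/-- The tuple `(i₁, …, i_r)` of nodes of a sortie. -/
def nodes (π : Sortie N) : List N := π.start :: (π.served ++ [π.finish])

/-- The flight time of a sortie. -/
def duration (I : Problem N) (π : Sortie N) : ℝ := pathLength I.droneTime π.nodes

/-- The energy consumption of a sortie: the weight of the drone is carried all the way, the payload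
of a served node is carried from the starting node to that node. -/
def energy (I : Problem N) (π : Sortie N) : ℝ :=
  I.droneWeight * π.duration I +
    ∑ p : Fin π.served.length, I.payload (π.served.get p) *
      pathLength I.droneTime (π.start :: π.served.take ((p : ℕ) + 1))

/-- The feasible sorties. Consecutive nodes are distinct, as every step of a sortie is an arc. -/
structure IsFeasible (I : Problem N) (π : Sortie N) : Prop where
  served_ne_nil : π.served ≠ []
  start_mem : π.start ∈ I.truckNodes
  finish_mem : π.finish ∈ I.truckNodes
  served_mem : ∀ i ∈ π.served, i ∈ I.droneNodes
  arcs : π.nodes.IsChain (· ≠ ·)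
  energy_le : π.energy I ≤ I.battery

end Sortie

/-- A sortie flown in a solution whose truck route has `n` arcs: the drone is launched from the
truck during the visit number `launchAt` of the truck route, and retrieved by the truck during the
visit number `landAt`. -/
structure Flight (N : Type) (n : ℕ) where
  sortie : Sortie N
  launchAt : Fin (n + 1)
  landAt : Fin (n + 1)

/-- A truck route with `n` arcs together with, for each of `m` drones, the list of its flights in
the order in which they are flown. -/
structure Solution (N : Type) (m : ℕ) where
  n : ℕ
  route : Fin (n + 1) → N
  flights : Fin m → List (Flight N n)

/-- The times at which the truck arrives at and departs from each visit of its route, and the times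
at which the drones are launched and retrieved. -/
structure Schedule {N : Type} {m : ℕ} (S : Solution N m) where
  arrive : Fin (S.n + 1) → ℝ
  depart : Fin (S.n + 1) → ℝ
  launch : (d : Fin m) → Fin (S.flights d).length → ℝ
  retrieve : (d : Fin m) → Fin (S.flights d).length → ℝ

/-- The schedule `σ` is consistent: the operation starts at time `0`; the truck needs the travel
time of each arc it traverses, and may wait at each visit; every drone is launched and retrieved
while the truck is present, may wait to be retrieved after its flight, and starts a new flight only
after having been retrieved from the previous one. -/
structure Schedule.IsValid {N : Type} (I : Problem N) {S : Solution N I.numDrones}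
    (σ : Schedule S) : Prop where
  arrive_zero : σ.arrive 0 = 0
  arrive_le_depart : ∀ k, σ.arrive k ≤ σ.depart k
  drive : ∀ k : Fin S.n, σ.arrive k.succ =
    σ.depart k.castSucc + I.truckTime (S.route k.castSucc) (S.route k.succ)
  launch_mem : ∀ d q, σ.launch d q ∈
    Set.Icc (σ.arrive ((S.flights d).get q).launchAt) (σ.depart ((S.flights d).get q).launchAt)
  retrieve_mem : ∀ d q, σ.retrieve d q ∈
    Set.Icc (σ.arrive ((S.flights d).get q).landAt) (σ.depart ((S.flights d).get q).landAt)
  fly : ∀ d q, σ.launch d q + ((S.flights d).get q).sortie.duration I ≤ σ.retrieve d q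
  successive : ∀ d q q', q < q' → σ.retrieve d q ≤ σ.launch d q'

namespace Solution

variable {N : Type}

/-- The times at which the whole operation can be finished, i.e., at which the truck may end its
last visit (to the depot), all drones having been retrieved. -/
def finishTimes (I : Problem N) (S : Solution N I.numDrones) : Set ℝ :=
  {T | ∃ σ : Schedule S, σ.IsValid I ∧ σ.depart (Fin.last S.n) = T}

/-- The completion time (objective value) of a solution: its earliest possible finish time. -/
def completionTime (I : Problem N) (S : Solution N I.numDrones) : ℝ := sInf (S.finishTimes I)

/-- The feasible solutions. -/
structure IsFeasible (I : Problem N) (S : Solution N I.numDrones) : Prop where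
  -- the truck route is a closed walk through the depot that visits truck nodes only
  route_zero : S.route 0 = I.depot
  route_last : S.route (Fin.last S.n) = I.depot
  route_mem : ∀ k, S.route k ∈ I.truckNodes
  route_arcs : ∀ k : Fin S.n, S.route k.castSucc ≠ S.route k.succ
  -- each flight is a feasible sortie launched and retrieved by the truck at nodes of its route
  sortie_feasible : ∀ d, ∀ f ∈ S.flights d, f.sortie.IsFeasible I
  start_eq : ∀ d, ∀ f ∈ S.flights d, f.sortie.start = S.route f.launchAt
  finish_eq : ∀ d, ∀ f ∈ S.flights d, f.sortie.finish = S.route f.landAt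
  launch_le_land : ∀ d, ∀ f ∈ S.flights d, f.launchAt ≤ f.landAt
  -- each drone flies one sortie at a time
  successive : ∀ d, (S.flights d).Pairwise fun f g => f.landAt ≤ g.launchAt
  -- every node is visited by the truck or served by a drone
  serves : ∀ i : N, (∃ k, S.route k = i) ∨ ∃ d, ∃ f ∈ S.flights d, i ∈ f.sortie.served
  -- truck and drones can be synchronised
  schedulable : (S.finishTimes I).Nonempty

/-- The truck traverses some arc more than once (in the same direction). -/
def IsArcRetraversing {m : ℕ} (S : Solution N m) : Prop :=
  ∃ k k' : Fin S.n, k ≠ k' ∧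
    S.route k.castSucc = S.route k'.castSucc ∧ S.route k.succ = S.route k'.succ

/-- The optimal solutions. -/
def IsOptimal (I : Problem N) (S : Solution N I.numDrones) : Prop :=
  S.IsFeasible I ∧
    ∀ S' : Solution N I.numDrones, S'.IsFeasible I → S.completionTime I ≤ S'.completionTime I

/-- The solutions that are optimal under the restriction that no arc may be retraversed. -/
def IsOptimalWithoutRetraversal (I : Problem N) (S : Solution N I.numDrones) : Prop :=
  S.IsFeasible I ∧ ¬ S.IsArcRetraversing ∧
    ∀ S' : Solution N I.numDrones, S'.IsFeasible I → ¬ S'.IsArcRetraversing →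
      S.completionTime I ≤ S'.completionTime I

end Solution

end TSPmD

end

noncomputable section

namespace TSPmD

/-! ### Path lengths -/

section PathLength

variable {N : Type} {d : N → N → ℝ}

/-! The truck may visit only the depot and the two points (∓19.135, 0), nodes 1 and 2; everything
else must be flown. The cost is decided by six key nodes, in three rows of two near the midpoint of
these points. A key node is 18 (middle row) or 18.75 (outer rows) away from the nearer truck node,
and the nodes of a row are 2.27 apart. The remaining nodes lie on the axis, where passing sorties
serve them for free.

The battery allows exactly 39.77 = 18.75 + 2.27 + 18.75. Hence a sortie cannot reach key nodes from
the depot or serve two rows, and one serving both nodes of a row must cross from one of the nodes 1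
and 2 to the other (`of_pair_sublist`). All flights that serve key nodes lie between the truck's
first possible arrival at 1 or 2 and its last possible departure from there, so the completion time
is at least 2 · 466.275 plus their total duration. This duration is bounded by giving each key node
a share, `weight`, of its sortie (`le_of_mem_finishTimes`).

If all rows are paired, the shares sum to 38.27 + 2 · 39.77 = 117.81, which gives 1050.36. If some
row is not, its nodes need separate round trips, which costs at least 33.73 more and gives 1084.09.
Three paired rows force three successive crossings, and a truck alternating between 1 and 2 must
then repeat an arc; an intermediate return to the depot is far too expensive
(`le_of_not_isArcRetraversing`). Two explicit solutions, in which the drone flies without pause,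
attain both bounds. -/

theorem IsMetric.nonneg (hd : IsMetric d) (i j : N) : 0 ≤ d i j := by
  have h := hd.triangle i j i
  rw [(hd.eq_zero_iff i i).2 rfl, hd.symm j i] at h
  linarith

theorem pathLength_cons_le_cons_cons (hd : IsMetric d) (i j : N) (l : List N) :
    pathLength d (i :: l) ≤ pathLength d (i :: j :: l) := by
  cases l with
  | nil => simpa [pathLength] using hd.nonneg i j
  | cons k l =>
    simp only [pathLength]
    linarith [hd.triangle i j k]

/-- By the triangle inequality, skipping stops never lengthens a path. This reduces every bound on a
sortie to the one or two served nodes of interest. -/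
theorem pathLength_cons_le_of_sublist (hd : IsMetric d) {l l' : List N} (h : l.Sublist l') :
    ∀ i, pathLength d (i :: l) ≤ pathLength d (i :: l') := by
  induction h with
  | slnil => simp
  | cons j _ ih => exact fun i => (ih i).trans (pathLength_cons_le_cons_cons hd i j _)
  | cons_cons j _ ih =>
    intro i
    simp only [pathLength]
    linarith [ih j]

theorem Sortie.duration_ge_of_sublist {I : Problem N} (π : Sortie N) {l : List N}
    (h : l.Sublist π.served) :
    pathLength I.droneTime (π.start :: (l ++ [π.finish])) ≤ π.duration I :=
  pathLength_cons_le_of_sublist I.droneTime_isMetric (h.append_right _) _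

end PathLength

/-- Two distinct members of a list occur in it in one of the two orders. -/
theorem pair_sublist_of_mem {α : Type*} {l : List α} {p q : α} (hp : p ∈ l) (hq : q ∈ l)
    (hpq : p ≠ q) : [p, q].Sublist l ∨ [q, p].Sublist l := by
  induction l with
  | nil => simp at hp
  | cons a l ih =>
    rcases List.mem_cons.1 hp with rfl | hp'
    · rcases List.mem_cons.1 hq with rfl | hq'
      · exact absurd rfl hpq
      · exact Or.inl ((List.singleton_sublist.2 hq').cons_cons _)
    · rcases List.mem_cons.1 hq with rfl | hq'
      · exact Or.inr ((List.singleton_sublist.2 hp').cons_cons _)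
      · exact (ih hp' hq').imp (fun h => h.cons _) fun h => h.cons _

/-! ### Schedules -/

/-- Disjoint intervals in a window. Induction removes the last interval: all others end before it
starts, so its start becomes the right end of a smaller window, which is why `a` and `b` are
generalized. -/
theorem sum_length_le_of_successive {n : ℕ} {l r : Fin n → ℝ}
    (hs : ∀ q q', q < q' → r q ≤ l q') (Q : Finset (Fin n)) :
    ∀ {a b : ℝ}, a ≤ b → (∀ q ∈ Q, a ≤ l q ∧ r q ≤ b) → ∑ q ∈ Q, (r q - l q) ≤ b - a := by
  induction Q using Finset.induction_on_max with
  | empty => intro a b hab _; simpa using hab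
  | insert q Q hq ih =>
    intro a b _ h
    rw [Finset.sum_insert fun hmem => lt_irrefl _ (hq q hmem)]
    have hq' := h q (Finset.mem_insert_self q Q)
    have := ih hq'.1 fun q' hq'Q =>
      ⟨(h q' (Finset.mem_insert_of_mem hq'Q)).1, hs q' q (hq q' hq'Q)⟩
    linarith [hq'.2]

/-- Waiting and detours only delay the truck, so by the triangle inequality the direct travel time
bounds the elapsed time. -/
theorem Schedule.IsValid.depart_add_le {N : Type} {I : Problem N} {S : Solution N I.numDrones}
    {σ : Schedule S} (hσ : σ.IsValid I) {j k : Fin (S.n + 1)} (hjk : j < k) :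
    σ.depart j + I.truckTime (S.route j) (S.route k) ≤ σ.arrive k := by
  induction k using Fin.induction with
  | zero => exact absurd hjk (Fin.not_lt_zero j)
  | succ k ih =>
    rw [hσ.drive k]
    rcases lt_or_eq_of_le (Fin.le_castSucc_iff.2 hjk) with h | rfl
    · linarith [ih h, hσ.arrive_le_depart k.castSucc,
        I.truckTime_isMetric.triangle (S.route j) (S.route k.castSucc) (S.route k.succ)]
    · rfl

theorem Schedule.IsValid.le_arrive {N : Type} {I : Problem N} {S : Solution N I.numDrones}
    {σ : Schedule S} (hσ : σ.IsValid I) (k : Fin (S.n + 1)) :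
    I.truckTime (S.route 0) (S.route k) ≤ σ.arrive k := by
  rcases eq_or_ne k 0 with rfl | hk
  · rw [(I.truckTime_isMetric.eq_zero_iff _ _).2 rfl, hσ.arrive_zero]
  · linarith [hσ.depart_add_le (Fin.pos_of_ne_zero hk), hσ.arrive_le_depart 0, hσ.arrive_zero]

theorem Schedule.IsValid.depart_add_le_depart_last {N : Type} {I : Problem N}
    {S : Solution N I.numDrones} {σ : Schedule S} (hσ : σ.IsValid I) (k : Fin (S.n + 1)) :
    σ.depart k + I.truckTime (S.route k) (S.route (Fin.last S.n)) ≤ σ.depart (Fin.last S.n) := by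
  rcases eq_or_ne k (Fin.last S.n) with rfl | hk
  · rw [(I.truckTime_isMetric.eq_zero_iff _ _).2 rfl, add_zero]
  · linarith [hσ.depart_add_le (Fin.lt_last_iff_ne_last.2 hk),
      hσ.arrive_le_depart (Fin.last S.n)]

/-! ### The instance -/

namespace Example

/-- The ordinate of the depot, which is at distance `466.275` from both other truck nodes. -/
def depotHeight : ℝ := √(466.275 ^ 2 - 19.135 ^ 2)

/-- The abscissas of the nodes. -/
def abscissa : Fin 15 → ℝ :=
  -- The numbers make the relevant distances rational: 19.135 - 1.135 = 18 and 18² + 5.25² = 18.75².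
  ![0, -19.135, 19.135, -1.135, 1.135, -1.135, 1.135, -1.135, 1.135, -5, -10, -15, 5, 10, 15]

/-- The ordinates of the nodes. -/
def ordinate : Fin 15 → ℝ :=
  ![depotHeight, 0, 0, 0, 0, 5.25, 5.25, -5.25, -5.25, 0, 0, 0, 0, 0, 0]

/-- The positions of the nodes. -/
def position (i : Fin 15) : EuclideanSpace ℝ (Fin 2) := !₂[abscissa i, ordinate i]

theorem depotHeight_sq : depotHeight ^ 2 = 466.275 ^ 2 - 19.135 ^ 2 :=
  Real.sq_sqrt (by norm_num)

theorem depotHeight_ge : 400 ≤ depotHeight := Real.le_sqrt_of_sq_le (by norm_num)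

theorem dist_position (i j : Fin 15) : dist (position i) (position j) =
    √((abscissa i - abscissa j) ^ 2 + (ordinate i - ordinate j) ^ 2) := by
  rw [EuclideanSpace.dist_eq]
  simp [position, Real.dist_eq, sq_abs]

theorem dist_position_eq {i j : Fin 15} {r : ℝ} (hr : 0 ≤ r)
    (h : (abscissa i - abscissa j) ^ 2 + (ordinate i - ordinate j) ^ 2 = r ^ 2) :
    dist (position i) (position j) = r := by
  rw [dist_position, h, Real.sqrt_sq hr]

theorem le_dist_position {i j : Fin 15} {r : ℝ}
    (h : r ^ 2 ≤ (abscissa i - abscissa j) ^ 2 + (ordinate i - ordinate j) ^ 2) :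
    r ≤ dist (position i) (position j) := by
  rw [dist_position]
  exact Real.le_sqrt_of_sq_le h

theorem position_injective : Function.Injective position := by
  intro i j h
  have hx : abscissa i = abscissa j := by
    simpa [position] using congrArg (fun v : EuclideanSpace ℝ (Fin 2) => v 0) h
  have hy : ordinate i = ordinate j := by
    simpa [position] using congrArg (fun v : EuclideanSpace ℝ (Fin 2) => v 1) h
  have := depotHeight_ge
  clear h
  -- Distinct nodes share an abscissa only in the columns ±1.135, where the ordinates 0, 5.25 and
  -- -5.25 separate them.
  fin_cases i <;> fin_cases j <;> first
    | rfl
    | (exfalso; revert hx; norm_num [abscissa]; done)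
    | (exfalso; revert hy; norm_num [ordinate])

theorem isMetric_dist_position : IsMetric fun i j => dist (position i) (position j) where
  eq_zero_iff i j := by rw [dist_eq_zero, position_injective.eq_iff]
  symm i j := dist_comm _ _
  triangle i j k := dist_triangle _ _ _

/-- The instance: the truck may visit the nodes `0` (the depot), `1` and `2` only, and the drone has
to serve all the other nodes. -/
def problem : Problem (Fin 15) where
  depot := 0
  truckNodes := {i | i < 3}
  droneNodes := {i | 3 ≤ i}
  depot_mem := by simp
  cover := by
    ext i
    simpa using lt_or_ge i 3
  truckTime i j := dist (position i) (position j)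
  droneTime i j := dist (position i) (position j)
  truckTime_isMetric := isMetric_dist_position
  droneTime_isMetric := isMetric_dist_position
  numDrones := 1
  droneWeight := 1
  droneWeight_pos := one_pos
  payload _ := 0
  payload_nonneg _ := le_rfl
  -- Just enough for a crossing through an outer row: 18.75 + 2.27 + 18.75.
  battery := 39.77
  battery_pos := by norm_num

/-! ### Coordinates and the distances that restrict the sorties. -/

theorem abscissa_apply :
    abscissa 0 = 0 ∧ abscissa 1 = -19.135 ∧ abscissa 2 = 19.135 ∧ abscissa 3 = -1.135 ∧
    abscissa 4 = 1.135 ∧ abscissa 5 = -1.135 ∧ abscissa 6 = 1.135 ∧ abscissa 7 = -1.135 ∧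
    abscissa 8 = 1.135 ∧ abscissa 9 = -5 ∧ abscissa 10 = -10 ∧ abscissa 11 = -15 ∧
    abscissa 12 = 5 ∧ abscissa 13 = 10 ∧ abscissa 14 = 15 :=
  ⟨rfl, rfl, rfl, rfl, rfl, rfl, rfl, rfl, rfl, rfl, rfl, rfl, rfl, rfl, rfl⟩

theorem ordinate_apply :
    ordinate 0 = depotHeight ∧ ordinate 1 = 0 ∧ ordinate 2 = 0 ∧ ordinate 3 = 0 ∧
    ordinate 4 = 0 ∧ ordinate 5 = 5.25 ∧ ordinate 6 = 5.25 ∧ ordinate 7 = -5.25 ∧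
    ordinate 8 = -5.25 ∧ ordinate 9 = 0 ∧ ordinate 10 = 0 ∧ ordinate 11 = 0 ∧
    ordinate 12 = 0 ∧ ordinate 13 = 0 ∧ ordinate 14 = 0 :=
  ⟨rfl, rfl, rfl, rfl, rfl, rfl, rfl, rfl, rfl, rfl, rfl, rfl, rfl, rfl, rfl⟩

/-- The nodes that determine the costs of the sorties. The other nodes served by the drone lie on
segments between these nodes and the truck nodes. -/
def keyNodes : Finset (Fin 15) := {3, 4, 5, 6, 7, 8}

/-- The key nodes form three rows of two nodes each. -/
def row (p : Fin 15) : ℕ := (p - 3) / 2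

/-- The travel time between a key node and the closer one of the truck nodes `1` and `2`. -/
def nearTime (p : Fin 15) : ℝ := if row p = 0 then 18 else 18.75

theorem mem_keyNodes {p : Fin 15} :
    p ∈ keyNodes ↔ p = 3 ∨ p = 4 ∨ p = 5 ∨ p = 6 ∨ p = 7 ∨ p = 8 := by
  simp [keyNodes]

theorem droneTime_comm (i j : Fin 15) : problem.droneTime i j = problem.droneTime j i :=
  dist_comm _ _

theorem droneTime_eq {i j : Fin 15} {r : ℝ} (hr : 0 ≤ r)
    (h : (abscissa i - abscissa j) ^ 2 + (ordinate i - ordinate j) ^ 2 = r ^ 2) :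
    problem.droneTime i j = r := dist_position_eq hr h

theorem le_droneTime {i j : Fin 15} {r : ℝ}
    (h : r ^ 2 ≤ (abscissa i - abscissa j) ^ 2 + (ordinate i - ordinate j) ^ 2) :
    r ≤ problem.droneTime i j := le_dist_position h

theorem nearTime_le {s p : Fin 15} (hs : s = 1 ∨ s = 2) (hp : p ∈ keyNodes) :
    nearTime p ≤ problem.droneTime s p := by
  apply le_droneTime
  rcases hs with rfl | rfl <;> rcases mem_keyNodes.1 hp with rfl | rfl | rfl | rfl | rfl | rfl <;>
    norm_num [nearTime, row, abscissa_apply, ordinate_apply]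

theorem battery_lt_droneTime_depot {p : Fin 15} (hp : p ∈ keyNodes) :
    39.77 < problem.droneTime 0 p := by
  have hH := depotHeight_ge
  refine lt_of_lt_of_le (by norm_num : (39.77 : ℝ) < 40) (le_droneTime ?_)
  rcases mem_keyNodes.1 hp with rfl | rfl | rfl | rfl | rfl | rfl <;>
    norm_num [abscissa_apply, ordinate_apply] <;> nlinarith

/-- The vertical gap alone suffices: adjacent rows already give 18 + 5.25 + 18.75 = 42. -/
theorem battery_lt_of_row_ne {p q : Fin 15} (hp : p ∈ keyNodes) (hq : q ∈ keyNodes)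
    (h : row p ≠ row q) : 39.77 < nearTime p + problem.droneTime p q + nearTime q := by
  suffices h' : 39.77 < nearTime p + |ordinate p - ordinate q| + nearTime q by
    have : |ordinate p - ordinate q| ≤ problem.droneTime p q :=
      le_droneTime (by rw [sq_abs]; exact le_add_of_nonneg_left (sq_nonneg _))
    linarith
  rcases mem_keyNodes.1 hp with rfl | rfl | rfl | rfl | rfl | rfl <;>
    rcases mem_keyNodes.1 hq with rfl | rfl | rfl | rfl | rfl | rfl <;>
    first
      | exact absurd rfl h
      | norm_num [nearTime, row, ordinate_apply, abs_of_pos, abs_of_neg]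

theorem droneTime_of_row_eq {p q : Fin 15} (hp : p ∈ keyNodes) (hq : q ∈ keyNodes)
    (hpq : p ≠ q) (h : row p = row q) : problem.droneTime p q = 2.27 := by
  rcases mem_keyNodes.1 hp with rfl | rfl | rfl | rfl | rfl | rfl <;>
    rcases mem_keyNodes.1 hq with rfl | rfl | rfl | rfl | rfl | rfl <;>
    first
      | exact absurd rfl hpq
      | (exfalso; revert h; decide)
      | (apply droneTime_eq <;> norm_num [ordinate_apply, abscissa_apply])

/-- One node of each row lies beyond the midpoint as seen from `s`, at horizontal distance 19.135 +
1.135 = 20.27. -/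
theorem farTime_le {s p q : Fin 15} (hs : s = 1 ∨ s = 2) (hp : p ∈ keyNodes) (hq : q ∈ keyNodes)
    (hpq : p ≠ q) (h : row p = row q) :
    20.27 ≤ problem.droneTime s p ∨ 20.27 ≤ problem.droneTime s q := by
  have key : ∀ {s r : Fin 15}, 20.27 ≤ |abscissa s - abscissa r| →
      20.27 ≤ problem.droneTime s r := fun {s r} hsr => hsr.trans <|
    le_droneTime (by rw [sq_abs]; exact le_add_of_nonneg_right (sq_nonneg _))
  refine Or.imp key key ?_
  rcases hs with rfl | rfl <;> rcases mem_keyNodes.1 hp with rfl | rfl | rfl | rfl | rfl | rfl <;>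
    rcases mem_keyNodes.1 hq with rfl | rfl | rfl | rfl | rfl | rfl <;>
    first
      | exact absurd rfl hpq
      | (exfalso; revert h; decide)
      | norm_num [abscissa_apply, abs_of_pos, abs_of_neg]

theorem nearTime_ge (p : Fin 15) : 18 ≤ nearTime p := by
  unfold nearTime
  split_ifs <;> norm_num

/-! ### The feasible sorties -/

theorem energy_eq (π : Sortie (Fin 15)) : π.energy problem = π.duration problem := by
  simp [Sortie.energy, problem]

section FeasibleSortie

variable {π : Sortie (Fin 15)} {p q : Fin 15}

theorem duration_le (hπ : π.IsFeasible problem) : π.duration problem ≤ 39.77 :=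
  energy_eq π ▸ hπ.energy_le

theorem eq_one_or_two {s : Fin 15} (hs : s ∈ problem.truckNodes) (h : s ≠ 0) : s = 1 ∨ s = 2 := by
  have hs' : s < 3 := hs
  omega

theorem duration_ge_of_mem (hp : p ∈ π.served) :
    problem.droneTime π.start p + problem.droneTime p π.finish ≤ π.duration problem := by
  simpa [pathLength] using π.duration_ge_of_sublist (I := problem) (List.singleton_sublist.2 hp)

theorem duration_ge_of_pair (h : [p, q].Sublist π.served) :
    problem.droneTime π.start p + problem.droneTime p q + problem.droneTime q π.finish ≤
      π.duration problem := by
  simpa [pathLength, add_assoc] using π.duration_ge_of_sublist (I := problem) h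

theorem start_finish_of_mem (hπ : π.IsFeasible problem) (hp : p ∈ keyNodes) (h : p ∈ π.served) :
    (π.start = 1 ∨ π.start = 2) ∧ (π.finish = 1 ∨ π.finish = 2) := by
  have h₁ := duration_ge_of_mem h
  have h₂ := duration_le hπ
  have h₃ := battery_lt_droneTime_depot hp
  refine ⟨eq_one_or_two hπ.start_mem fun h0 => ?_, eq_one_or_two hπ.finish_mem fun h0 => ?_⟩
  · rw [h0] at h₁
    linarith [problem.droneTime_isMetric.nonneg p π.finish]
  · rw [h0, droneTime_comm p 0] at h₁
    linarith [problem.droneTime_isMetric.nonneg π.start p]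

theorem two_mul_nearTime_le (hπ : π.IsFeasible problem) (hp : p ∈ keyNodes) (h : p ∈ π.served) :
    2 * nearTime p ≤ π.duration problem := by
  obtain ⟨hs, hf⟩ := start_finish_of_mem hπ hp h
  have := duration_ge_of_mem h
  rw [droneTime_comm p] at this
  linarith [nearTime_le hs hp, nearTime_le hf hp]

/-- A battery count. Different rows are too far apart; and if the sortie returned to its starting
node, one of the two nodes would be the far one, for a length of at least 20.27 + 2.27 + 18 = 40.54.
-/
theorem of_pair_sublist (hπ : π.IsFeasible problem) (hp : p ∈ keyNodes) (hq : q ∈ keyNodes)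
    (hpq : p ≠ q) (h : [p, q].Sublist π.served) :
    row p = row q ∧ π.start ≠ π.finish ∧ nearTime p + nearTime q + 2.27 ≤ π.duration problem := by
  have hpm : p ∈ π.served := h.subset (by simp)
  obtain ⟨hs, hf⟩ := start_finish_of_mem hπ hp hpm
  have h₁ := duration_ge_of_pair h
  have h₂ := duration_le hπ
  rw [droneTime_comm q] at h₁
  have hsp := nearTime_le hs hp
  have hfq := nearTime_le hf hq
  have hrow : row p = row q := by
    by_contra hne
    linarith [battery_lt_of_row_ne hp hq hne]
  rw [droneTime_of_row_eq hp hq hpq hrow] at h₁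
  refine ⟨hrow, fun heq => ?_, by linarith⟩
  rw [← heq] at h₁ hfq
  rcases farTime_le hs hp hq hpq hrow with h₃ | h₃
  · linarith [nearTime_ge q]
  · linarith [nearTime_ge p]

theorem of_mem_mem (hπ : π.IsFeasible problem) (hp : p ∈ keyNodes) (hq : q ∈ keyNodes)
    (hpq : p ≠ q) (hps : p ∈ π.served) (hqs : q ∈ π.served) :
    row p = row q ∧ π.start ≠ π.finish ∧ nearTime p + nearTime q + 2.27 ≤ π.duration problem := by
  rcases pair_sublist_of_mem hps hqs hpq with h | h
  · exact of_pair_sublist hπ hp hq hpq h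
  · obtain ⟨h₁, h₂, h₃⟩ := of_pair_sublist hπ hq hp hpq.symm h
    exact ⟨h₁.symm, h₂, by linarith⟩

theorem eq_or_eq_of_row_eq {r : Fin 15} (hp : p ∈ keyNodes) (hq : q ∈ keyNodes)
    (hr : r ∈ keyNodes) (hpq : p ≠ q) (h : row p = row q) (h' : row p = row r) :
    r = p ∨ r = q := by
  revert p q r
  decide

/-- A lower bound for the share of a key node in the cost of the sorties if no sortie serves both
nodes of row `k`. -/
def weight (k : ℕ) (p : Fin 15) : ℝ :=
  if row p = k then 2 * nearTime p else nearTime p + 1.135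

theorem weight_le (k : ℕ) (p : Fin 15) : weight k p ≤ 2 * nearTime p := by
  unfold weight
  split_ifs
  · rfl
  · linarith [nearTime_ge p]

/-- A feasible sortie serves at most two key nodes, as two of them share a row and a row has only
two. A pair splits its cost evenly, each node taking half of the gap 2.27; by `hk` this never
happens in row `k`, whose nodes can therefore be charged a full round trip. -/
theorem sum_weight_le (k : ℕ) (hπ : π.IsFeasible problem)
    (hk : ∀ p ∈ keyNodes, ∀ q ∈ keyNodes, p ≠ q → p ∈ π.served → q ∈ π.served → row p ≠ k)
    (hp : p ∈ keyNodes) (hps : p ∈ π.served) :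
    ∑ r ∈ keyNodes with r ∈ π.served, weight k r ≤ π.duration problem := by
  have hmem : p ∈ keyNodes.filter (· ∈ π.served) := Finset.mem_filter.2 ⟨hp, hps⟩
  by_cases hq : ∃ q ∈ keyNodes, p ≠ q ∧ q ∈ π.served
  · obtain ⟨q, hq, hpq, hqs⟩ := hq
    obtain ⟨hrow, -, hdur⟩ := of_mem_mem hπ hp hq hpq hps hqs
    have hset : keyNodes.filter (· ∈ π.served) = {p, q} := by
      ext r
      simp only [Finset.mem_filter, Finset.mem_insert, Finset.mem_singleton]
      constructor
      · rintro ⟨hr, hrs⟩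
        by_cases hpr : p = r
        · exact Or.inl hpr.symm
        · exact eq_or_eq_of_row_eq hp hq hr hpq hrow (of_mem_mem hπ hp hr hpr hps hrs).1
      · rintro (rfl | rfl)
        exacts [⟨hp, hps⟩, ⟨hq, hqs⟩]
    rw [hset, Finset.sum_pair hpq, weight, weight, if_neg (hk p hp q hq hpq hps hqs),
      if_neg (hk q hq p hp hpq.symm hqs hps)]
    linarith
  · have hset : keyNodes.filter (· ∈ π.served) = {p} := by
      refine Finset.eq_singleton_iff_unique_mem.2 ⟨hmem, fun r hr => ?_⟩
      obtain ⟨hr, hrs⟩ := Finset.mem_filter.1 hr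
      by_contra hne
      exact hq ⟨r, hr, Ne.symm hne, hrs⟩
    rw [hset, Finset.sum_singleton]
    exact (weight_le k p).trans (two_mul_nearTime_le hπ hp hps)

end FeasibleSortie

/-! ### Total weights of the key nodes. -/

theorem sum_keyNodes (f : Fin 15 → ℝ) :
    ∑ p ∈ keyNodes, f p = f 3 + f 4 + f 5 + f 6 + f 7 + f 8 := by
  simp [keyNodes, add_assoc]

theorem row_lt_three {p : Fin 15} (hp : p ∈ keyNodes) : row p < 3 := by
  revert p
  decide

/-- No row of key nodes has such a number, so every node is charged as half of a pair: 38.27 + 2 ·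
39.77. -/
theorem sum_weight_of_ge {k : ℕ} (hk : 3 ≤ k) : ∑ p ∈ keyNodes, weight k p = 117.81 := by
  have : ∀ p ∈ keyNodes, weight k p = nearTime p + 1.135 := fun p hp => if_neg fun h => by
    have := row_lt_three hp
    omega
  rw [Finset.sum_congr rfl this, sum_keyNodes]
  norm_num [nearTime, row]

/-- The middle row is the cheapest one to leave unpaired: 4 · 18 + 2 · 39.77 = 151.54. -/
theorem sum_weight_ge {k : ℕ} (hk : k < 3) : 151.54 ≤ ∑ p ∈ keyNodes, weight k p := by
  rw [sum_keyNodes]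
  interval_cases k <;> norm_num [weight, nearTime, row]

/-! ### Lower bounds on the completion time -/

/-- The only drone. -/
def drone : Fin problem.numDrones := (0 : Fin 1)

theorem eq_drone (d : Fin problem.numDrones) : d = drone := Subsingleton.elim (α := Fin 1) d 0

theorem truckTime_depot {s : Fin 15} (hs : s = 1 ∨ s = 2) : problem.truckTime 0 s = 466.275 := by
  apply dist_position_eq <;> rcases hs with rfl | rfl <;>
    norm_num [abscissa_apply, ordinate_apply, depotHeight_sq]

section LowerBound

variable {S : Solution (Fin 15) problem.numDrones}

theorem exists_flight (hS : S.IsFeasible problem) {p : Fin 15} (hp : p ∈ keyNodes) :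
    ∃ q, p ∈ ((S.flights drone).get q).sortie.served := by
  rcases hS.serves p with ⟨k, rfl⟩ | ⟨d, f, hf, hpf⟩
  · have h₁ : S.route k < 3 := hS.route_mem k
    have h₂ : 3 ≤ S.route k := by
      revert hp
      generalize S.route k = i
      revert i
      decide
    exact absurd h₁ (not_lt.2 h₂)
  · rw [eq_drone d] at hf
    obtain ⟨q, rfl⟩ := List.get_of_mem hf
    exact ⟨q, hpf⟩

/-- Flights serving key nodes are disjoint in time and confined to a window of length `T - 932.55`,
where 932.55 = 2 · 466.275; their durations pay for the weights of all key nodes. -/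
theorem le_of_mem_finishTimes (hS : S.IsFeasible problem) (k : ℕ)
    (hk : ∀ f ∈ S.flights drone, ∀ p ∈ keyNodes, ∀ q ∈ keyNodes, p ≠ q →
      p ∈ f.sortie.served → q ∈ f.sortie.served → row p ≠ k)
    {T : ℝ} (hT : T ∈ S.finishTimes problem) :
    932.55 + ∑ p ∈ keyNodes, weight k p ≤ T := by
  obtain ⟨σ, hσ, rfl⟩ := hT
  set L := S.flights drone
  have hmem : ∀ q, L.get q ∈ L := fun q => List.get_mem L q
  have hQ : ∀ q, (∃ p ∈ keyNodes, p ∈ (L.get q).sortie.served) →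
      466.275 ≤ σ.launch drone q ∧
        σ.retrieve drone q ≤ σ.depart (Fin.last S.n) - 466.275 := by
    rintro q ⟨p, hp, hps⟩
    obtain ⟨hs, hf⟩ := start_finish_of_mem (hS.sortie_feasible drone _ (hmem q)) hp hps
    rw [hS.start_eq drone _ (hmem q)] at hs
    rw [hS.finish_eq drone _ (hmem q)] at hf
    have h₁ := hσ.le_arrive (L.get q).launchAt
    have h₂ := hσ.depart_add_le_depart_last (L.get q).landAt
    rw [hS.route_zero, show problem.depot = 0 from rfl, truckTime_depot hs] at h₁
    rw [hS.route_last, problem.truckTime_isMetric.symm, show problem.depot = 0 from rfl,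
      truckTime_depot hf] at h₂
    exact ⟨h₁.trans (hσ.launch_mem drone q).1, by linarith [(hσ.retrieve_mem drone q).2]⟩
  -- The window is nonempty because it contains a flight, for instance one that serves node 3.
  have hab : (466.275 : ℝ) ≤ σ.depart (Fin.last S.n) - 466.275 := by
    obtain ⟨q, hq⟩ := exists_flight hS (show (3 : Fin 15) ∈ keyNodes by decide)
    have h := hQ q ⟨3, by decide, hq⟩
    have := two_mul_nearTime_le (hS.sortie_feasible drone _ (hmem q)) (by decide) hq
    linarith [nearTime_ge 3, hσ.fly drone q]
  classical
  set Q : Finset (Fin L.length) := {q | ∃ p ∈ keyNodes, p ∈ (L.get q).sortie.served}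
  have hsum := sum_length_le_of_successive (fun q q' => hσ.successive drone q q') Q hab
    fun q hq => hQ q (Finset.mem_filter.1 hq).2
  have hweight : ∀ p, 0 ≤ weight k p := fun p => by
    unfold weight
    split_ifs <;> linarith [nearTime_ge p]
  -- Only an inequality, as a node may be served by several flights.
  have hcover : ∑ p ∈ keyNodes, weight k p ≤
      ∑ p ∈ keyNodes, ∑ q ∈ Q, if p ∈ (L.get q).sortie.served then weight k p else 0 := by
    refine Finset.sum_le_sum fun p hp => ?_
    obtain ⟨q, hq⟩ := exists_flight hS hp
    have hqQ : q ∈ Q := Finset.mem_filter.2 ⟨Finset.mem_univ q, p, hp, hq⟩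
    refine le_trans (le_of_eq (if_pos hq).symm) (Finset.single_le_sum (f := fun q =>
      if p ∈ (L.get q).sortie.served then weight k p else 0) (fun q _ => ?_) hqQ)
    split_ifs
    exacts [hweight p, le_rfl]
  rw [Finset.sum_comm] at hcover
  have hcost : ∑ q ∈ Q, ∑ p ∈ keyNodes,
      (if p ∈ (L.get q).sortie.served then weight k p else 0) ≤
        ∑ q ∈ Q, (σ.retrieve drone q - σ.launch drone q) := by
    refine Finset.sum_le_sum fun q hq => ?_
    obtain ⟨p, hp, hps⟩ := (Finset.mem_filter.1 hq).2
    rw [← Finset.sum_filter]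
    have := sum_weight_le k (hS.sortie_feasible drone _ (hmem q)) (hk _ (hmem q)) hp hps
    linarith [hσ.fly drone q]
  linarith

theorem le_of_isFeasible (hS : S.IsFeasible problem) {T : ℝ} (hT : T ∈ S.finishTimes problem) :
    1050.36 ≤ T := by
  -- With `k = 3`, which numbers no row of key nodes, the pairing hypothesis holds trivially.
  have h := le_of_mem_finishTimes hS 3 (fun f _ p hp _ _ _ _ _ => (row_lt_three hp).ne) hT
  rw [sum_weight_of_ge le_rfl] at h
  linarith

/-- The visits just before and just after an intermediate depot visit are at node 1 or 2, so the
truck covers the distance 466.275 four times. -/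
theorem le_of_route_eq_depot (hS : S.IsFeasible problem) {T : ℝ}
    (hT : T ∈ S.finishTimes problem) {j : Fin (S.n + 1)} (h0 : j ≠ 0) (hl : j ≠ Fin.last S.n)
    (hj : S.route j = 0) : 1865.1 ≤ T := by
  obtain ⟨σ, hσ, rfl⟩ := hT
  obtain ⟨i, rfl⟩ := Fin.exists_succ_eq.2 h0
  obtain ⟨i', hi'⟩ := Fin.exists_castSucc_eq.2 hl
  have h₁ := eq_one_or_two (hS.route_mem i.castSucc) (hj ▸ hS.route_arcs i)
  have h₂ := eq_one_or_two (hS.route_mem i'.succ) fun h =>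
    hS.route_arcs i' (by rw [hi', hj, h])
  have h₃ := hσ.le_arrive i.castSucc
  have h₄ := hσ.depart_add_le_depart_last i'.succ
  rw [hS.route_zero, show problem.depot = 0 from rfl, truckTime_depot h₁] at h₃
  rw [hS.route_last, problem.truckTime_isMetric.symm, show problem.depot = 0 from rfl,
    truckTime_depot h₂] at h₄
  have h₅ := hσ.drive i
  have h₆ := hσ.drive i'
  rw [hj, problem.truckTime_isMetric.symm, truckTime_depot h₁] at h₅
  rw [hi', hj, truckTime_depot h₂] at h₆
  linarith [hσ.arrive_le_depart i.castSucc, hσ.arrive_le_depart i.succ,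
    hσ.arrive_le_depart i'.succ]

/-- Visits 1 to 4 alternate between the nodes 1 and 2, so the arc leaving visit 1 equals the arc
leaving visit 3. -/
theorem isArcRetraversing_of_five_le (hS : S.IsFeasible problem) (hn : 5 ≤ S.n)
    (h : ∀ j, j ≠ 0 → j ≠ Fin.last S.n → S.route j ≠ 0) : S.IsArcRetraversing := by
  have hr : ∀ i (h₀ : i ≠ 0) (hi : i < S.n), S.route ⟨i, by omega⟩ = 1 ∨
      S.route ⟨i, by omega⟩ = 2 := fun i h₀ hi =>
    eq_one_or_two (hS.route_mem _) (h _ (by simpa [Fin.ext_iff] using h₀)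
      (by simpa [Fin.ext_iff] using hi.ne))
  have ha : ∀ i (hi : i < S.n), S.route ⟨i, by omega⟩ ≠ S.route ⟨i + 1, by omega⟩ := fun i hi =>
    hS.route_arcs ⟨i, hi⟩
  have h₁ := hr 1 (by omega) (by omega)
  have h₂ := hr 2 (by omega) (by omega)
  have h₃ := hr 3 (by omega) (by omega)
  have h₄ := hr 4 (by omega) (by omega)
  have h₁₂ := ha 1 (by omega)
  have h₂₃ := ha 2 (by omega)
  have h₃₄ := ha 3 (by omega)
  refine ⟨⟨1, by omega⟩, ⟨3, by omega⟩, by simp, ?_, ?_⟩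
  · change S.route ⟨1, _⟩ = S.route ⟨3, _⟩
    grind
  · change S.route ⟨2, _⟩ = S.route ⟨4, _⟩
    grind

theorem le_of_not_isArcRetraversing (hS : S.IsFeasible problem) (hr : ¬ S.IsArcRetraversing)
    {T : ℝ} (hT : T ∈ S.finishTimes problem) : 1084.09 ≤ T := by
  by_cases hdep : ∃ j, j ≠ 0 ∧ j ≠ Fin.last S.n ∧ S.route j = 0
  · obtain ⟨j, h0, hl, hj⟩ := hdep
    linarith [le_of_route_eq_depot hS hT h0 hl hj]
  -- Either some row is never served as a pair, and the weights give the bound, or all three rows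
  -- are, which forces five arcs.
  suffices h : ∃ k < 3, ∀ f ∈ S.flights drone, ∀ p ∈ keyNodes, ∀ q ∈ keyNodes, p ≠ q →
      p ∈ f.sortie.served → q ∈ f.sortie.served → row p ≠ k by
    obtain ⟨k, hk3, hk⟩ := h
    linarith [le_of_mem_finishTimes hS k hk hT, sum_weight_ge hk3]
  by_contra! hcon
  refine hr (isArcRetraversing_of_five_le hS ?_ fun j h0 hl hj => hdep ⟨j, h0, hl, hj⟩)
  -- A pair sortie joins the nodes 1 and 2, so its launch and landing are different visits, neither
  -- of them the first or last visit at the depot.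
  have key : ∀ k < 3, ∃ q : Fin (S.flights drone).length,
      (∃ p ∈ keyNodes, p ∈ ((S.flights drone).get q).sortie.served ∧ row p = k) ∧
      0 < (((S.flights drone).get q).launchAt : ℕ) ∧
      (((S.flights drone).get q).launchAt : ℕ) < ((S.flights drone).get q).landAt ∧
      (((S.flights drone).get q).landAt : ℕ) < S.n := by
    intro k hk
    obtain ⟨f, hf, p, hp, p', hp', hpp', hps, hps', hrow⟩ := hcon k hk
    obtain ⟨q, rfl⟩ := List.get_of_mem hf
    have hfeas := hS.sortie_feasible drone _ hf
    obtain ⟨hs, hfin⟩ := start_finish_of_mem hfeas hp hps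
    have hne := (of_mem_mem hfeas hp hp' hpp' hps hps').2.1
    rw [hS.start_eq drone _ hf] at hs hne
    rw [hS.finish_eq drone _ hf] at hfin hne
    refine ⟨q, ⟨p, hp, hps, hrow⟩, ?_, ?_, ?_⟩
    · refine Nat.pos_of_ne_zero fun h => ?_
      rw [show ((S.flights drone).get q).launchAt = 0 from Fin.ext h, hS.route_zero] at hs
      revert hs
      change ¬ ((0 : Fin 15) = 1 ∨ (0 : Fin 15) = 2)
      decide
    · exact lt_of_le_of_ne (hS.launch_le_land drone _ hf) fun h => hne (by rw [Fin.ext h])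
    · refine lt_of_le_of_ne (Nat.lt_succ_iff.1 (Fin.is_lt _)) fun h => ?_
      rw [show ((S.flights drone).get q).landAt = Fin.last S.n from Fin.ext h,
        hS.route_last] at hfin
      revert hfin
      change ¬ ((0 : Fin 15) = 1 ∨ (0 : Fin 15) = 2)
      decide
  have hsucc : ∀ q q' : Fin (S.flights drone).length, q < q' →
      (((S.flights drone).get q).landAt : ℕ) ≤ ((S.flights drone).get q').launchAt :=
    fun q q' h => List.pairwise_iff_get.1 (hS.successive drone) q q' h
  have hrow : ∀ q p p', p ∈ keyNodes → p' ∈ keyNodes →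
      p ∈ ((S.flights drone).get q).sortie.served →
      p' ∈ ((S.flights drone).get q).sortie.served → row p = row p' := by
    intro q p p' hp hp' hps hps'
    by_cases hpp' : p = p'
    · rw [hpp']
    · exact (of_mem_mem (hS.sortie_feasible drone _ (List.get_mem _ q)) hp hp' hpp' hps hps').1
  obtain ⟨q₀, ⟨p₀, hp₀, hs₀, hr₀⟩, h₀⟩ := key 0 (by norm_num)
  obtain ⟨q₁, ⟨p₁, hp₁, hs₁, hr₁⟩, h₁⟩ := key 1 (by norm_num)
  obtain ⟨q₂, ⟨p₂, hp₂, hs₂, hr₂⟩, h₂⟩ := key 2 (by norm_num)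
  have n₀₁ : q₀ ≠ q₁ := by
    rintro rfl
    have := hrow _ _ _ hp₀ hp₁ hs₀ hs₁
    omega
  have n₀₂ : q₀ ≠ q₂ := by
    rintro rfl
    have := hrow _ _ _ hp₀ hp₂ hs₀ hs₂
    omega
  have n₁₂ : q₁ ≠ q₂ := by
    rintro rfl
    have := hrow _ _ _ hp₁ hp₂ hs₁ hs₂
    omega
  -- The three flights are distinct, as each serves one row only. Two of the eight cases are cyclic
  -- and impossible; in each of the six orders, three disjoint crossings strictly inside the route
  -- need visits up to number 4 before the last one.
  rcases lt_or_gt_of_ne n₀₁ with a | a <;> rcases lt_or_gt_of_ne n₀₂ with b | b <;>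
    rcases lt_or_gt_of_ne n₁₂ with c | c <;>
    first
      | exact absurd (a.trans c) b.not_gt
      | exact absurd (b.trans a) c.not_gt
      | exact absurd (a.trans b) c.not_gt
      | (have := hsucc _ _ a
         have := hsucc _ _ b
         have := hsucc _ _ c
         omega)

end LowerBound

/-! ### Two solutions -/

/-- A sortie from node `1` to node `2` that serves the key nodes of row `1`. -/
def topSortie : Sortie (Fin 15) := ⟨1, [5, 6], 2⟩

/-- A sortie from node `2` to node `1` that serves the key nodes of row `2`. -/
def bottomSortie : Sortie (Fin 15) := ⟨2, [8, 7], 1⟩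

/-- A sortie from node `1` to node `2` that serves all the nodes in between. -/
def axisSortie : Sortie (Fin 15) := ⟨1, [11, 10, 9, 3, 4, 12, 13, 14], 2⟩

/-- A sortie from node `1` and back that serves the left half of the nodes of `axisSortie`. -/
def leftSortie : Sortie (Fin 15) := ⟨1, [11, 10, 9, 3], 1⟩

/-- A sortie from node `2` and back that serves the right half of the nodes of `axisSortie`. -/
def rightSortie : Sortie (Fin 15) := ⟨2, [14, 13, 12, 4], 2⟩

theorem droneTime_values :
    problem.droneTime 1 5 = 18.75 ∧ problem.droneTime 5 6 = 2.27 ∧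
    problem.droneTime 6 2 = 18.75 ∧ problem.droneTime 2 8 = 18.75 ∧
    problem.droneTime 8 7 = 2.27 ∧ problem.droneTime 7 1 = 18.75 ∧
    problem.droneTime 1 11 = 4.135 ∧ problem.droneTime 11 10 = 5 ∧
    problem.droneTime 10 9 = 5 ∧ problem.droneTime 9 3 = 3.865 ∧
    problem.droneTime 3 4 = 2.27 ∧ problem.droneTime 4 12 = 3.865 ∧
    problem.droneTime 12 13 = 5 ∧ problem.droneTime 13 14 = 5 ∧
    problem.droneTime 14 2 = 4.135 ∧ problem.droneTime 3 1 = 18 ∧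
    problem.droneTime 2 14 = 4.135 ∧ problem.droneTime 14 13 = 5 ∧
    problem.droneTime 13 12 = 5 ∧ problem.droneTime 12 4 = 3.865 ∧
    problem.droneTime 4 2 = 18 := by
  refine ⟨?_, ?_, ?_, ?_, ?_, ?_, ?_, ?_, ?_, ?_, ?_, ?_, ?_, ?_, ?_, ?_, ?_, ?_, ?_, ?_, ?_⟩ <;>
    (apply droneTime_eq <;> norm_num [abscissa_apply, ordinate_apply])

theorem duration_topSortie : topSortie.duration problem = 39.77 := by
  norm_num [topSortie, Sortie.duration, Sortie.nodes, pathLength, droneTime_values]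

theorem duration_bottomSortie : bottomSortie.duration problem = 39.77 := by
  norm_num [bottomSortie, Sortie.duration, Sortie.nodes, pathLength, droneTime_values]

theorem duration_axisSortie : axisSortie.duration problem = 38.27 := by
  norm_num [axisSortie, Sortie.duration, Sortie.nodes, pathLength, droneTime_values]

theorem duration_leftSortie : leftSortie.duration problem = 36 := by
  norm_num [leftSortie, Sortie.duration, Sortie.nodes, pathLength, droneTime_values]

theorem duration_rightSortie : rightSortie.duration problem = 36 := by
  norm_num [rightSortie, Sortie.duration, Sortie.nodes, pathLength, droneTime_values]

theorem isFeasible_of_duration_le {π : Sortie (Fin 15)} (h₀ : π.served ≠ []) (h₁ : π.start < 3)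
    (h₂ : π.finish < 3) (h₃ : ∀ i ∈ π.served, 3 ≤ i) (h₄ : π.nodes.IsChain (· ≠ ·))
    (h₅ : π.duration problem ≤ 39.77) : π.IsFeasible problem :=
  ⟨h₀, h₁, h₂, h₃, h₄, (energy_eq π).trans_le h₅⟩

theorem isFeasible_topSortie : topSortie.IsFeasible problem :=
  isFeasible_of_duration_le (by decide) (by decide) (by decide) (by decide) (by decide)
    (by norm_num [duration_topSortie])

theorem isFeasible_bottomSortie : bottomSortie.IsFeasible problem :=
  isFeasible_of_duration_le (by decide) (by decide) (by decide) (by decide) (by decide)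
    (by norm_num [duration_bottomSortie])

theorem isFeasible_axisSortie : axisSortie.IsFeasible problem :=
  isFeasible_of_duration_le (by decide) (by decide) (by decide) (by decide) (by decide)
    (by norm_num [duration_axisSortie])

theorem isFeasible_leftSortie : leftSortie.IsFeasible problem :=
  isFeasible_of_duration_le (by decide) (by decide) (by decide) (by decide) (by decide)
    (by norm_num [duration_leftSortie])

theorem isFeasible_rightSortie : rightSortie.IsFeasible problem :=
  isFeasible_of_duration_le (by decide) (by decide) (by decide) (by decide) (by decide)
    (by norm_num [duration_rightSortie])

theorem truckTime_values :
    problem.truckTime 0 1 = 466.275 ∧ problem.truckTime 1 2 = 38.27 ∧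
    problem.truckTime 2 1 = 38.27 ∧ problem.truckTime 1 0 = 466.275 ∧
    problem.truckTime 2 0 = 466.275 := by
  refine ⟨truckTime_depot (Or.inl rfl), ?_, ?_, ?_, ?_⟩ <;>
    (apply dist_position_eq <;> norm_num [abscissa_apply, ordinate_apply, depotHeight_sq])

/-- A solution that traverses the arc from node `1` to node `2` twice. -/
def retraversingSolution : Solution (Fin 15) problem.numDrones where
  n := 5
  route := ![0, 1, 2, 1, 2, 0]
  flights _ := [⟨topSortie, 1, 2⟩, ⟨bottomSortie, 2, 3⟩, ⟨axisSortie, 3, 4⟩]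

/-- A solution that traverses each arc at most once. -/
def simpleSolution : Solution (Fin 15) problem.numDrones where
  n := 4
  route := ![0, 1, 2, 1, 0]
  flights _ := [⟨topSortie, 1, 2⟩, ⟨rightSortie, 2, 2⟩, ⟨bottomSortie, 2, 3⟩, ⟨leftSortie, 3, 3⟩]

/-- A schedule of `retraversingSolution`. -/
def retraversingSchedule : Schedule retraversingSolution where
  -- The truck crosses in 38.27 but an outer row takes the drone 39.77, so the truck waits 1.5 at
  -- visits 2 and 3; the drone itself is never idle between 466.275 and 584.085.
  arrive := (![0, 466.275, 504.545, 544.315, 584.085, 1050.36] : Fin 6 → ℝ)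
  depart := (![0, 466.275, 506.045, 545.815, 584.085, 1050.36] : Fin 6 → ℝ)
  launch _ := (![466.275, 506.045, 545.815] : Fin 3 → ℝ)
  retrieve _ := (![506.045, 545.815, 584.085] : Fin 3 → ℝ)

/-- A schedule of `simpleSolution`. -/
def simpleSchedule : Schedule simpleSolution where
  -- At visits 2 and 3 the truck waits 37.5 = 1.5 + 36: for the crossing drone, and for its round
  -- trip over half of the axis.
  arrive := (![0, 466.275, 504.545, 580.315, 1084.09] : Fin 5 → ℝ)
  depart := (![0, 466.275, 542.045, 617.815, 1084.09] : Fin 5 → ℝ)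
  launch _ := (![466.275, 506.045, 542.045, 581.815] : Fin 4 → ℝ)
  retrieve _ := (![506.045, 542.045, 581.815, 617.815] : Fin 4 → ℝ)

theorem isValid_retraversingSchedule : retraversingSchedule.IsValid problem where
  arrive_zero := rfl
  arrive_le_depart := by
    change ∀ k : Fin 6, _
    intro k
    fin_cases k
    · change (0 : ℝ) ≤ 0
      norm_num
    · change (466.275 : ℝ) ≤ 466.275
      norm_num
    · change (504.545 : ℝ) ≤ 506.045
      norm_num
    · change (544.315 : ℝ) ≤ 545.815
      norm_num
    · change (584.085 : ℝ) ≤ 584.085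
      norm_num
    · change (1050.36 : ℝ) ≤ 1050.36
      norm_num
  drive := by
    change ∀ k : Fin 5, _
    intro k
    fin_cases k
    · change (466.275 : ℝ) = 0 + problem.truckTime 0 1
      norm_num [truckTime_values]
    · change (504.545 : ℝ) = 466.275 + problem.truckTime 1 2
      norm_num [truckTime_values]
    · change (544.315 : ℝ) = 506.045 + problem.truckTime 2 1
      norm_num [truckTime_values]
    · change (584.085 : ℝ) = 545.815 + problem.truckTime 1 2
      norm_num [truckTime_values]
    · change (1050.36 : ℝ) = 584.085 + problem.truckTime 2 0
      norm_num [truckTime_values]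
  launch_mem := by
    change ∀ _ : Fin 1, ∀ q : Fin 3, _
    intro _ q
    fin_cases q
    · change (466.275 : ℝ) ∈ Set.Icc (466.275 : ℝ) 466.275
      norm_num
    · change (506.045 : ℝ) ∈ Set.Icc (504.545 : ℝ) 506.045
      norm_num
    · change (545.815 : ℝ) ∈ Set.Icc (544.315 : ℝ) 545.815
      norm_num
  retrieve_mem := by
    change ∀ _ : Fin 1, ∀ q : Fin 3, _
    intro _ q
    fin_cases q
    · change (506.045 : ℝ) ∈ Set.Icc (504.545 : ℝ) 506.045
      norm_num
    · change (545.815 : ℝ) ∈ Set.Icc (544.315 : ℝ) 545.815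
      norm_num
    · change (584.085 : ℝ) ∈ Set.Icc (584.085 : ℝ) 584.085
      norm_num
  fly := by
    change ∀ _ : Fin 1, ∀ q : Fin 3, _
    intro _ q
    fin_cases q
    · change (466.275 : ℝ) + topSortie.duration problem ≤ 506.045
      norm_num [duration_topSortie]
    · change (506.045 : ℝ) + bottomSortie.duration problem ≤ 545.815
      norm_num [duration_bottomSortie]
    · change (545.815 : ℝ) + axisSortie.duration problem ≤ 584.085
      norm_num [duration_axisSortie]
  successive := by
    change ∀ _ : Fin 1, ∀ q q' : Fin 3, q < q' → _
    intro _ q q' h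
    fin_cases q <;> fin_cases q' <;> first
      | exact absurd h (by decide)
      | skip
    · change (506.045 : ℝ) ≤ 506.045
      norm_num
    · change (506.045 : ℝ) ≤ 545.815
      norm_num
    · change (545.815 : ℝ) ≤ 545.815
      norm_num

theorem isValid_simpleSchedule : simpleSchedule.IsValid problem where
  arrive_zero := rfl
  arrive_le_depart := by
    change ∀ k : Fin 5, _
    intro k
    fin_cases k
    · change (0 : ℝ) ≤ 0
      norm_num
    · change (466.275 : ℝ) ≤ 466.275
      norm_num
    · change (504.545 : ℝ) ≤ 542.045
      norm_num
    · change (580.315 : ℝ) ≤ 617.815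
      norm_num
    · change (1084.09 : ℝ) ≤ 1084.09
      norm_num
  drive := by
    change ∀ k : Fin 4, _
    intro k
    fin_cases k
    · change (466.275 : ℝ) = 0 + problem.truckTime 0 1
      norm_num [truckTime_values]
    · change (504.545 : ℝ) = 466.275 + problem.truckTime 1 2
      norm_num [truckTime_values]
    · change (580.315 : ℝ) = 542.045 + problem.truckTime 2 1
      norm_num [truckTime_values]
    · change (1084.09 : ℝ) = 617.815 + problem.truckTime 1 0
      norm_num [truckTime_values]
  launch_mem := by
    change ∀ _ : Fin 1, ∀ q : Fin 4, _
    intro _ q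
    fin_cases q
    · change (466.275 : ℝ) ∈ Set.Icc (466.275 : ℝ) 466.275
      norm_num
    · change (506.045 : ℝ) ∈ Set.Icc (504.545 : ℝ) 542.045
      norm_num
    · change (542.045 : ℝ) ∈ Set.Icc (504.545 : ℝ) 542.045
      norm_num
    · change (581.815 : ℝ) ∈ Set.Icc (580.315 : ℝ) 617.815
      norm_num
  retrieve_mem := by
    change ∀ _ : Fin 1, ∀ q : Fin 4, _
    intro _ q
    fin_cases q
    · change (506.045 : ℝ) ∈ Set.Icc (504.545 : ℝ) 542.045
      norm_num
    · change (542.045 : ℝ) ∈ Set.Icc (504.545 : ℝ) 542.045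
      norm_num
    · change (581.815 : ℝ) ∈ Set.Icc (580.315 : ℝ) 617.815
      norm_num
    · change (617.815 : ℝ) ∈ Set.Icc (580.315 : ℝ) 617.815
      norm_num
  fly := by
    change ∀ _ : Fin 1, ∀ q : Fin 4, _
    intro _ q
    fin_cases q
    · change (466.275 : ℝ) + topSortie.duration problem ≤ 506.045
      norm_num [duration_topSortie]
    · change (506.045 : ℝ) + rightSortie.duration problem ≤ 542.045
      norm_num [duration_rightSortie]
    · change (542.045 : ℝ) + bottomSortie.duration problem ≤ 581.815
      norm_num [duration_bottomSortie]
    · change (581.815 : ℝ) + leftSortie.duration problem ≤ 617.815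
      norm_num [duration_leftSortie]
  successive := by
    change ∀ _ : Fin 1, ∀ q q' : Fin 4, q < q' → _
    intro _ q q' h
    fin_cases q <;> fin_cases q' <;> first
      | exact absurd h (by decide)
      | skip
    · change (506.045 : ℝ) ≤ 506.045
      norm_num
    · change (506.045 : ℝ) ≤ 542.045
      norm_num
    · change (506.045 : ℝ) ≤ 581.815
      norm_num
    · change (542.045 : ℝ) ≤ 542.045
      norm_num
    · change (542.045 : ℝ) ≤ 581.815
      norm_num
    · change (581.815 : ℝ) ≤ 581.815
      norm_num

/-! ### Feasibility and exact completion times of the two solutions. -/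

theorem mem_finishTimes_retraversingSolution :
    1050.36 ∈ retraversingSolution.finishTimes problem :=
  ⟨retraversingSchedule, isValid_retraversingSchedule, rfl⟩

theorem mem_finishTimes_simpleSolution : 1084.09 ∈ simpleSolution.finishTimes problem :=
  ⟨simpleSchedule, isValid_simpleSchedule, rfl⟩

theorem mem_flights_retraversingSolution {d : Fin problem.numDrones}
    {f : Flight (Fin 15) retraversingSolution.n} :
    f ∈ retraversingSolution.flights d ↔
      f = (⟨topSortie, 1, 2⟩ : Flight (Fin 15) 5) ∨
      f = (⟨bottomSortie, 2, 3⟩ : Flight (Fin 15) 5) ∨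
      f = (⟨axisSortie, 3, 4⟩ : Flight (Fin 15) 5) :=
  List.mem_cons.trans (or_congr_right (List.mem_cons.trans (or_congr_right List.mem_singleton)))

theorem isFeasible_retraversingSolution : retraversingSolution.IsFeasible problem where
  route_zero := rfl
  route_last := rfl
  route_mem := by
    change ∀ k : Fin 6, retraversingSolution.route k < 3
    decide
  route_arcs := by
    change ∀ k : Fin 5, retraversingSolution.route k.castSucc ≠ retraversingSolution.route k.succ
    decide
  sortie_feasible := by
    intro d f hf
    rcases mem_flights_retraversingSolution.1 hf with rfl | rfl | rfl
    exacts [isFeasible_topSortie, isFeasible_bottomSortie, isFeasible_axisSortie]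
  start_eq := by
    intro d f hf
    rcases mem_flights_retraversingSolution.1 hf with rfl | rfl | rfl
    all_goals rfl
  finish_eq := by
    intro d f hf
    rcases mem_flights_retraversingSolution.1 hf with rfl | rfl | rfl
    all_goals rfl
  launch_le_land := by
    intro d f hf
    rcases mem_flights_retraversingSolution.1 hf with rfl | rfl | rfl
    all_goals decide
  successive _ := by
    simp only [retraversingSolution]
    decide
  serves := by
    have key : ∀ i : Fin 15, (i = 0 ∨ i = 1 ∨ i = 2) ∨
        i ∈ topSortie.served ∨ i ∈ bottomSortie.served ∨ i ∈ axisSortie.served := by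
      decide
    intro i
    rcases key i with (rfl | rfl | rfl) | h
    · exact Or.inl ⟨(0 : Fin 6), rfl⟩
    · exact Or.inl ⟨(1 : Fin 6), rfl⟩
    · exact Or.inl ⟨(2 : Fin 6), rfl⟩
    · refine Or.inr ⟨drone, ?_⟩
      rcases h with h | h | h
      · exact ⟨_, mem_flights_retraversingSolution.2 (Or.inl rfl), h⟩
      · exact ⟨_, mem_flights_retraversingSolution.2 (Or.inr (Or.inl rfl)), h⟩
      · exact ⟨_, mem_flights_retraversingSolution.2 (Or.inr (Or.inr rfl)), h⟩
  schedulable := ⟨_, mem_finishTimes_retraversingSolution⟩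

theorem mem_flights_simpleSolution {d : Fin problem.numDrones}
    {f : Flight (Fin 15) simpleSolution.n} :
    f ∈ simpleSolution.flights d ↔
      f = (⟨topSortie, 1, 2⟩ : Flight (Fin 15) 4) ∨
      f = (⟨rightSortie, 2, 2⟩ : Flight (Fin 15) 4) ∨
      f = (⟨bottomSortie, 2, 3⟩ : Flight (Fin 15) 4) ∨
      f = (⟨leftSortie, 3, 3⟩ : Flight (Fin 15) 4) :=
  List.mem_cons.trans (or_congr_right (List.mem_cons.trans (or_congr_right
    (List.mem_cons.trans (or_congr_right List.mem_singleton)))))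

theorem isFeasible_simpleSolution : simpleSolution.IsFeasible problem where
  route_zero := rfl
  route_last := rfl
  route_mem := by
    change ∀ k : Fin 5, simpleSolution.route k < 3
    decide
  route_arcs := by
    change ∀ k : Fin 4, simpleSolution.route k.castSucc ≠ simpleSolution.route k.succ
    decide
  sortie_feasible := by
    intro d f hf
    rcases mem_flights_simpleSolution.1 hf with rfl | rfl | rfl | rfl
    exacts [isFeasible_topSortie, isFeasible_rightSortie, isFeasible_bottomSortie, isFeasible_leftSortie]
  start_eq := by
    intro d f hf
    rcases mem_flights_simpleSolution.1 hf with rfl | rfl | rfl | rfl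
    all_goals rfl
  finish_eq := by
    intro d f hf
    rcases mem_flights_simpleSolution.1 hf with rfl | rfl | rfl | rfl
    all_goals rfl
  launch_le_land := by
    intro d f hf
    rcases mem_flights_simpleSolution.1 hf with rfl | rfl | rfl | rfl
    all_goals decide
  successive _ := by
    simp only [simpleSolution]
    decide
  serves := by
    have key : ∀ i : Fin 15, (i = 0 ∨ i = 1 ∨ i = 2) ∨
        i ∈ topSortie.served ∨ i ∈ rightSortie.served ∨ i ∈ bottomSortie.served ∨ i ∈ leftSortie.served := by
      decide
    intro i
    rcases key i with (rfl | rfl | rfl) | h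
    · exact Or.inl ⟨(0 : Fin 5), rfl⟩
    · exact Or.inl ⟨(1 : Fin 5), rfl⟩
    · exact Or.inl ⟨(2 : Fin 5), rfl⟩
    · refine Or.inr ⟨drone, ?_⟩
      rcases h with h | h | h | h
      · exact ⟨_, mem_flights_simpleSolution.2 (Or.inl rfl), h⟩
      · exact ⟨_, mem_flights_simpleSolution.2 (Or.inr (Or.inl rfl)), h⟩
      · exact ⟨_, mem_flights_simpleSolution.2 (Or.inr (Or.inr (Or.inl rfl))), h⟩
      · exact ⟨_, mem_flights_simpleSolution.2 (Or.inr (Or.inr (Or.inr rfl))), h⟩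
  schedulable := ⟨_, mem_finishTimes_simpleSolution⟩

theorem isArcRetraversing_retraversingSolution : retraversingSolution.IsArcRetraversing :=
  ⟨(1 : Fin 5), (3 : Fin 5), show (1 : Fin 5) ≠ 3 by decide, rfl, rfl⟩

theorem not_isArcRetraversing_simpleSolution : ¬ simpleSolution.IsArcRetraversing := by
  change ¬ ∃ k k' : Fin 4, k ≠ k' ∧
    simpleSolution.route k.castSucc = simpleSolution.route k'.castSucc ∧
    simpleSolution.route k.succ = simpleSolution.route k'.succ
  decide

/-- The explicit schedule attains the general lower bound, so the infimum is a minimum. -/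
theorem completionTime_retraversingSolution :
    retraversingSolution.completionTime problem = 1050.36 :=
  IsLeast.csInf_eq ⟨mem_finishTimes_retraversingSolution,
    fun _ => le_of_isFeasible isFeasible_retraversingSolution⟩

theorem completionTime_simpleSolution : simpleSolution.completionTime problem = 1084.09 :=
  IsLeast.csInf_eq ⟨mem_finishTimes_simpleSolution, fun _ =>
    le_of_not_isArcRetraversing isFeasible_simpleSolution not_isArcRetraversing_simpleSolution⟩

theorem isOptimal_retraversingSolution : retraversingSolution.IsOptimal problem :=
  ⟨isFeasible_retraversingSolution, fun _ hS => completionTime_retraversingSolution.trans_le <|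
    le_csInf hS.schedulable fun _ => le_of_isFeasible hS⟩

theorem completionTime_ge_of_not_isArcRetraversing {S : Solution (Fin 15) problem.numDrones}
    (hS : S.IsFeasible problem) (hr : ¬ S.IsArcRetraversing) :
    1084.09 ≤ S.completionTime problem :=
  le_csInf hS.schedulable fun _ => le_of_not_isArcRetraversing hS hr

end Example
end TSPmD

end

theorem mainTheorem6 :
    ∃ (I : TSPmD.Problem (Fin 15)) (pos : Fin 15 → EuclideanSpace ℝ (Fin 2)),
      I.numDrones = 1 ∧
      (∀ i, I.payload i = 0) ∧
      (∀ i j, I.truckTime i j = dist (pos i) (pos j)) ∧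
      (∀ i j, I.droneTime i j = dist (pos i) (pos j)) ∧
      (∃ S : TSPmD.Solution (Fin 15) I.numDrones, S.IsOptimal I) ∧
      (∀ S : TSPmD.Solution (Fin 15) I.numDrones, S.IsOptimal I → S.IsArcRetraversing) ∧
      (∃ S₁ : TSPmD.Solution (Fin 15) I.numDrones, S₁.IsOptimalWithoutRetraversal I ∧
        |S₁.completionTime I - 1084.09| ≤ 0.005) ∧
      (∃ S₂ : TSPmD.Solution (Fin 15) I.numDrones, S₂.IsFeasible I ∧ S₂.IsArcRetraversing ∧
        |S₂.completionTime I - 1050.36| ≤ 0.005) := by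
  open TSPmD.Example in
  refine ⟨problem, position, rfl, fun _ => rfl, fun _ _ => rfl, fun _ _ => rfl,
    ⟨_, isOptimal_retraversingSolution⟩, fun S hS => ?_,
    ⟨simpleSolution, ⟨isFeasible_simpleSolution, not_isArcRetraversing_simpleSolution,
      fun S hS hr => completionTime_simpleSolution.trans_le
        (completionTime_ge_of_not_isArcRetraversing hS hr)⟩, ?_⟩,
    ⟨retraversingSolution, isFeasible_retraversingSolution,
      isArcRetraversing_retraversingSolution, ?_⟩⟩
  -- An optimal solution without a repeated arc would cost at least 1084.09, yet at most 1050.36.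
  · by_contra hr
    have h₁ := completionTime_ge_of_not_isArcRetraversing hS.1 hr
    have h₂ := hS.2 _ isFeasible_retraversingSolution
    rw [completionTime_retraversingSolution] at h₂
    linarith
  · norm_num [completionTime_simpleSolution]
  · norm_num [completionTime_retraversingSolution]
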